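/- A setup $\mathcal S$ consists of $n\ge 1$ items; item $i$ has a starting inventory $k_i\ge 1$ and a price set $\mathcal P_i=\{r_i^{(1)}<\dots<r_i^{(m_i)}\}$ of positive prices. An arrival sequence $\mathcal A$ is a finite sequence of customers $t=1,\dots,T$; customer $t$ is described by the probabilities $p^{(j)}_{t,i}\in[0,1]$ that she would buy item $i$ at price $r_i^{(j)}$. It is deterministic if every $p^{(j)}_{t,i}$ is $0$ or $1$. An online algorithm, possibly randomized, knows $\mathcal S$; for each arriving customer it sees her probabilities and then offers at most one item with remaining inventory, at one of its prices, based only on $\mathcal S$, the past customers, offers and purchase outcomes, the present customer, and its own randomness. If the customer buys, the price is earned and one unit of inventory is used. $\mathbb E[\mathsf{ALG}(\mathcal S,\mathcal A)]$ denotes its expected revenue, and $\mathsf{OPT}(\mathcal S,\mathcal A)$ is the maximum of $\sum_{t,i,j}p^{(j)}_{t,i}r_i^{(j)}x^{(j)}_{t,i}$ over $x\ge 0$ with $\sum_{t,j}p^{(j)}_{t,i}x^{(j)}_{t,i}\le k_i$ for all $i$ and $\sum_{i,j}x^{(j)}_{t,i}\le 1$ for all $t$. For a price set $\mathcal P=\{r^{(1)}<\dots<r^{(m)}\}$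 with $m\ge 1$ and $r^{(1)}>0$, put $r^{(0)}=0$ and let $\alpha^{(1)},\dots,\alpha^{(m)}$ be the unique positive numbers with sum $1$ such that $\frac{1-e^{-\alpha^{(j)}}}{1-r^{(j-1)}/r^{(j)}}=1-e^{-\alpha^{(1)}}$ for all $j$. Let $F(\mathcal P)=1-e^{-\alpha^{(1)}}$. Theorem. Let $k\ge 1$ be an integer and let $\mathcal P$ be any price set with $m\ge1$ prices. (1) For every $\varepsilon>0$ there are a setup $\mathcal S$ in which every item has starting inventory $k$ and price set $\mathcal P$, and a finitely supported distribution over deterministic arrival sequences $\mathcal A$ with $\mathbb E_{\mathcal A}[\mathsf{OPT}(\mathcal S,\mathcal A)]>0$, such that every online algorithm satisfies $\mathbb E_{\mathcal A}\big[\mathbb E[\mathsf{ALG}(\mathcal S,\mathcal A)]\big]\le (F(\mathcal P)+\varepsilon)\cdot\mathbb E_{\mathcal A}[\mathsf{OPT}(\mathcal S,\mathcal A)]$. (2) Consequently, the guarantee $\min_iF(\mathcal P_i)$ cannot be improved, neither in the deterministic case nor for large starting inventories: for every $c>F(\mathcal P)$ there is a setup $\mathcal S$ in which every item has starting inventory $k$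 and price set $\mathcal P$, such that no online algorithm, deterministic or randomized, satisfies $\mathbb E[\mathsf{ALG}(\mathcal S,\mathcal A)]\ge c\cdot\mathsf{OPT}(\mathcal S,\mathcal A)$ for all deterministic arrival sequences $\mathcal A$. -/

import Mathlib

open MeasureTheory

/-- A price set `0 < r⁽¹⁾ < ⋯ < r⁽ᵐ⁾` with `m ≥ 1` prices (indexed from `0` here). -/
structure PriceSet where
  m : ℕ
  m_pos : 0 < m
  r : Fin m → ℝ
  r_pos : ∀ j, 0 < r j
  r_strictMono : StrictMono r

namespace PriceSet

/-- The index of the lowest price. -/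
def first (P : PriceSet) : Fin P.m := ⟨0, P.m_pos⟩

/-- The price just below price `j`, with the convention `r⁽⁰⁾ = 0`. -/
def prev (P : PriceSet) (j : Fin P.m) : ℝ :=
  if j.val = 0 then 0 else P.r ⟨j.val - 1, lt_of_le_of_lt (Nat.sub_le _ _) j.isLt⟩

/-- The system defining the booking limits `α⁽¹⁾, …, α⁽ᵐ⁾`: they are positive, sum to `1`, and
`(1 - exp (-α⁽ʲ⁾)) / (1 - r⁽ʲ⁻¹⁾ / r⁽ʲ⁾)` is the same for all `j` (for `j = 1` it is
`1 - exp (-α⁽¹⁾)`, as `r⁽⁰⁾ = 0`). -/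
def IsBookingLimits (P : PriceSet) (α : Fin P.m → ℝ) : Prop :=
  (∀ j, 0 < α j) ∧ ∑ j, α j = 1 ∧
    ∀ j, 1 / (1 - P.prev j / P.r j) * (1 - Real.exp (-α j)) = 1 - Real.exp (-α P.first)

theorem coef_mem (P : PriceSet) (j : Fin P.m) :
    0 < 1 - P.prev j / P.r j ∧ 1 - P.prev j / P.r j ≤ 1 := by
  have h1 := P.r_pos j
  have h2 : 0 ≤ P.prev j ∧ P.prev j < P.r j := by
    unfold prev
    split_ifs with h
    · exact ⟨le_rfl, h1⟩
    · refine ⟨(P.r_pos _).le, P.r_strictMono ?_⟩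
      rw [Fin.lt_def]
      simp only
      omega
  refine ⟨?_, ?_⟩
  · have := (div_lt_one h1).2 h2.2
    linarith
  · have := div_nonneg h2.1 h1.le
    linarith

theorem coef_first (P : PriceSet) : 1 - P.prev P.first / P.r P.first = 1 := by
  simp [prev, first]

/-- The system for the booking limits has exactly one solution. -/
theorem existsUnique_bookingLimits (P : PriceSet) : ∃! α, P.IsBookingLimits α := by
  set c : Fin P.m → ℝ := fun j => 1 - P.prev j / P.r j with hc
  have c0 : ∀ j, 0 < c j := fun j => (P.coef_mem j).1
  have c1 : ∀ j, c j ≤ 1 := fun j => (P.coef_mem j).2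
  have cf : c P.first = 1 := P.coef_first
  have hpos : ∀ x : ℝ, 0 ≤ x → x < 1 → ∀ j, 0 < 1 - c j * x := by
    intro x h0 h1 j
    nlinarith [c0 j, c1 j]
  set s : ℝ → ℝ := fun x => ∑ j, -Real.log (1 - c j * x) with hs
  have smono : ∀ x y : ℝ, 0 ≤ x → x < y → y < 1 → s x < s y := by
    intro x y hx hxy hy
    refine Finset.sum_lt_sum_of_nonempty ⟨P.first, Finset.mem_univ _⟩ fun j _ => ?_
    have := Real.log_lt_log (hpos y (hx.trans hxy.le) hy j)
      (show 1 - c j * y < 1 - c j * x by nlinarith [c0 j])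
    linarith
  have key : ∀ α, P.IsBookingLimits α →
      0 < 1 - Real.exp (-α P.first) ∧ 1 - Real.exp (-α P.first) < 1 ∧
      (∀ j, α j = -Real.log (1 - c j * (1 - Real.exp (-α P.first)))) := by
    intro α h
    refine ⟨?_, ?_, fun j => ?_⟩
    · have : Real.exp (-α P.first) < 1 :=
        Real.exp_lt_one_iff.2 (by linarith [h.1 P.first])
      linarith
    · have := Real.exp_pos (-α P.first)
      linarith
    · have h2 := h.2.2 j
      have h3 : c j * (1 - Real.exp (-α P.first)) = 1 - Real.exp (-α j) := by
        rw [← h2]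
        have hne := (c0 j).ne'
        change c j * (1 / c j * (1 - Real.exp (-α j))) = _
        field_simp
      rw [h3]
      simp
  have hE : Real.exp (-1) < 1 := Real.exp_lt_one_iff.2 (by norm_num)
  have hE0 : 0 < Real.exp (-1) := Real.exp_pos _
  obtain ⟨x, hx, hsx⟩ : ∃ x ∈ Set.Icc (0 : ℝ) (1 - Real.exp (-1)), s x = 1 := by
    have hcont : ContinuousOn s (Set.Icc (0 : ℝ) (1 - Real.exp (-1))) := by
      refine continuousOn_finsetSum _ fun j _ => ContinuousOn.neg (ContinuousOn.log ?_ ?_)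
      · fun_prop
      · intro y hy
        exact (hpos y hy.1 (by linarith [hy.2]) j).ne'
    have hs0 : s 0 = 0 := by simp [hs]
    have hs1 : 1 ≤ s (1 - Real.exp (-1)) := by
      have h1 : -Real.log (1 - c P.first * (1 - Real.exp (-1))) = 1 := by
        rw [cf]
        simp
      refine h1.symm.le.trans (Finset.single_le_sum
        (f := fun j => -Real.log (1 - c j * (1 - Real.exp (-1))))
        (fun j _ => ?_) (Finset.mem_univ P.first))
      have ha := hpos (1 - Real.exp (-1)) (by linarith) (by linarith) j
      have := Real.log_nonpos ha.le (by nlinarith [c0 j])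
      linarith
    exact intermediate_value_Icc (by linarith) hcont ⟨by rw [hs0]; norm_num, hs1⟩
  have hx1 : x < 1 := by linarith [hx.2]
  have hx0 : 0 < x := by
    rcases hx.1.lt_or_eq with h | h
    · exact h
    · rw [← h] at hsx
      simp [hs] at hsx
  refine ⟨fun j => -Real.log (1 - c j * x), ⟨fun j => ?_, hsx, fun j => ?_⟩, ?_⟩
  · have := Real.log_neg (hpos x hx0.le hx1 j) (by nlinarith [c0 j])
    linarith
  · have hne := (c0 j).ne'
    change 1 / c j * _ = _
    rw [neg_neg, neg_neg, Real.exp_log (hpos x hx0.le hx1 j),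
      Real.exp_log (hpos x hx0.le hx1 P.first), cf]
    field_simp
    ring
  · intro β hβ
    obtain ⟨b0, b1, b2⟩ := key β hβ
    have hsb : s (1 - Real.exp (-β P.first)) = 1 := by
      exact (Finset.sum_congr rfl fun j _ => (b2 j).symm).trans hβ.2.1
    have hxb : 1 - Real.exp (-β P.first) = x := by
      rcases lt_trichotomy (1 - Real.exp (-β P.first)) x with h | h | h
      · have := smono _ _ b0.le h hx1
        linarith
      · exact h
      · have := smono _ _ hx0.le h b1
        linarith
    funext j
    rw [b2 j, hxb]

/-- The booking limits `α⁽¹⁾, …, α⁽ᵐ⁾` of a price set. -/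
noncomputable def bookingLimits (P : PriceSet) : Fin P.m → ℝ :=
  P.existsUnique_bookingLimits.choose

/-- `F(P) = 1 - exp (-α⁽¹⁾)`. -/
noncomputable def F (P : PriceSet) : ℝ := 1 - Real.exp (-P.bookingLimits P.first)

end PriceSet

/-- A setup: `n ≥ 1` items, item `i` having starting inventory `k i ≥ 1` and price set `P i`. -/
structure Setup where
  n : ℕ
  n_pos : 0 < n
  k : Fin n → ℕ
  k_pos : ∀ i, 0 < k i
  P : Fin n → PriceSet

/-- A customer: for each item and each of its prices, the probability that she would buy. -/
abbrev Customer (S : Setup) : Type := (i : Fin S.n) → Fin (S.P i).m → unitInterval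

/-- An arrival sequence: the finite list of customers, in order of arrival. -/
abbrev ArrivalSeq (S : Setup) : Type := List (Customer S)

/-- The deterministic case: every purchase probability is `0` or `1`. -/
def ArrivalSeq.IsDeterministic {S : Setup} (A : ArrivalSeq S) : Prop :=
  ∀ c ∈ A, ∀ i j, c i j = 0 ∨ c i j = 1

/-- The values of feasible solutions of the linear program: `x t i j` is the probability of
offering item `i` at price `j` to customer `t`. -/
def lpValues {S : Setup} (A : ArrivalSeq S) : Set ℝ :=
  {v | ∃ x : Fin A.length → (i : Fin S.n) → Fin (S.P i).m → ℝ,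
    (∀ t i j, 0 ≤ x t i j) ∧
    (∀ i, ∑ t, ∑ j, (A.get t i j : ℝ) * x t i j ≤ S.k i) ∧
    (∀ t, ∑ i, ∑ j, x t i j ≤ 1) ∧
    v = ∑ t, ∑ i, ∑ j, (A.get t i j : ℝ) * (S.P i).r j * x t i j}

/-- The optimal value of the linear program (its set of values is nonempty and bounded). -/
noncomputable def OPT {S : Setup} (A : ArrivalSeq S) : ℝ := sSup (lpValues A)

/-- An offer: an item, at one of its prices. -/
abbrev Offer (S : Setup) : Type := (i : Fin S.n) × Fin (S.P i).m

/-- What is observed about a past customer: her purchase probabilities, the offer made to her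
(if any), and whether she bought. -/
structure Event (S : Setup) where
  customer : Customer S
  offer : Option (Offer S)
  sold : Bool

/-- A deterministic online policy: it maps the past (most recent customer first) and the present
customer to an offer, or to no offer. -/
abbrev Policy (S : Setup) : Type := List (Event S) → Customer S → Option (Offer S)

/-- Expected revenue of a policy, over the purchase decisions of the customers `A` still to
arrive, when the remaining inventory is `inv` and the past is `h`. An item without remaining
inventory cannot be offered; choosing it counts as making no offer. -/
noncomputable def Policy.revenueFrom {S : Setup} (σ : Policy S) :
    (Fin S.n → ℕ) → List (Event S) → ArrivalSeq S → ℝ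
  | _, _, [] => 0
  | inv, h, c :: A =>
    match σ h c with
    | none => revenueFrom σ inv (⟨c, none, false⟩ :: h) A
    | some o =>
      if 0 < inv o.1 then
        (c o.1 o.2 : ℝ) * ((S.P o.1).r o.2 +
            revenueFrom σ (Function.update inv o.1 (inv o.1 - 1)) (⟨c, some o, true⟩ :: h) A) +
          (1 - (c o.1 o.2 : ℝ)) * revenueFrom σ inv (⟨c, some o, false⟩ :: h) A
      else revenueFrom σ inv (⟨c, none, false⟩ :: h) A

/-- A (possibly randomized) online algorithm for the setup `S`: a random seed drawn from an
arbitrary probability space, and for each seed a policy, chosen measurably. Deterministic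
algorithms have a one-point seed space. -/
structure OnlineAlgorithm (S : Setup) where
  Seed : Type
  [measurableSpace : MeasurableSpace Seed]
  law : Measure Seed
  [isProbabilityMeasure : IsProbabilityMeasure law]
  policy : Seed → Policy S
  measurableSet_policy : ∀ h c o, MeasurableSet {ω | policy ω h c = o}

attribute [instance] OnlineAlgorithm.measurableSpace OnlineAlgorithm.isProbabilityMeasure

/-- `E[ALG(S, A)]`: expected revenue over the seed and the purchase decisions. -/
noncomputable def OnlineAlgorithm.expectedRevenue {S : Setup} (alg : OnlineAlgorithm S)
    (A : ArrivalSeq S) : ℝ :=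
  ∫ ω, (alg.policy ω).revenueFrom S.k [] A ∂alg.law

/-- Expectation of `f` under a discrete distribution (used for finitely supported ones only). -/
noncomputable def expect {X : Type} (D : PMF X) (f : X → ℝ) : ℝ := ∑' x, (D x).toReal * f x

/-- The algorithm has competitive ratio `c` on its setup in the deterministic case. -/
def OnlineAlgorithm.IsDetCompetitive {S : Setup} (alg : OnlineAlgorithm S) (c : ℝ) : Prop :=
  ∀ A : ArrivalSeq S, A.IsDeterministic → c * OPT A ≤ alg.expectedRevenue A

/-!
The proof is an instance of Yao's principle: a random deterministic arrival sequence on which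
every deterministic policy does badly in expectation compared with the optimum in hindsight
(`OnlineAlgorithm.expect_expectedRevenue_le` passes from policies to randomized algorithms).

There are `N` identical items, all in demand at first. While `y` items are in demand, `k`
customers arrive who value each of these items at `v y`; then a uniformly random item falls out
of demand for good, until none is left (`arrivals`). In hindsight the item about to fall out is
sold to the `k` customers present, so the optimum is at least `k * ∑ y, v y`
(`isLPValue_arrivals`). A policy, on the other hand, cannot tell which items will last. The
average inventory over the items in demand is a martingale except for sales, and a sale lowers it
by `1 / y`. Pricing this average at `lam` bounds the revenue by
`k * (lam + ∑ y, max (v y - lam / y) 0)` (`Policy.expect_revenueFrom_arrivals_le`), which is weak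
duality for a fractional knapsack.

It remains to choose `v`. With `lam = M` large, let `v y` be the highest price `r j` such that
`r j * y ≤ M * exp (α j)`, where the `α j` are the booking limits. Since `∑ j, α j = 1`, the bound
on the revenue becomes `k * M * ∑ j, (exp (α j) - 1)` up to a constant. Since
`r j * exp (-α j) = r j - F * (r j - r (j - 1))`, the optimum is at least
`k * M * ∑ j, (exp (α j) - 1) / F` up to a constant (`PriceSet.exists_valuations`). Letting `M`
tend to infinity gives the ratio `F`.
-/

/-! ### Expectations under finitely supported distributions -/

section Expect

variable {X Y : Type}

theorem summable_toReal_mul {D : PMF X} (hD : D.support.Finite) (f : X → ℝ) :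
    Summable fun x => (D x).toReal * f x := by
  refine summable_of_hasFiniteSupport (hD.subset fun x hx => ?_)
  rw [PMF.mem_support_iff]
  intro h
  simp [h] at hx

theorem expect_mono {D : PMF X} (hD : D.support.Finite) {f g : X → ℝ}
    (h : ∀ x ∈ D.support, f x ≤ g x) : expect D f ≤ expect D g := by
  refine (summable_toReal_mul hD f).tsum_le_tsum (fun x => ?_) (summable_toReal_mul hD g)
  by_cases hx : x ∈ D.support
  · exact mul_le_mul_of_nonneg_left (h x hx) ENNReal.toReal_nonneg
  · simp [(D.apply_eq_zero_iff x).2 hx]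

theorem expect_const (D : PMF X) (a : ℝ) : expect D (fun _ => a) = a := by
  have h : ∑' x, (D x).toReal = 1 := by
    rw [← ENNReal.tsum_toReal_eq D.apply_ne_top, D.tsum_coe, ENNReal.toReal_one]
  rw [expect, tsum_mul_right, h, one_mul]

theorem expect_add {D : PMF X} (hD : D.support.Finite) (f g : X → ℝ) :
    expect D (fun x => f x + g x) = expect D f + expect D g := by
  simp only [expect, mul_add]
  exact (summable_toReal_mul hD f).tsum_add (summable_toReal_mul hD g)

theorem expect_const_mul (D : PMF X) (a : ℝ) (f : X → ℝ) :
    expect D (fun x => a * f x) = a * expect D f := by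
  simp only [expect, ← tsum_mul_left]
  exact tsum_congr fun x => by ring

theorem expect_pure (x : X) (f : X → ℝ) : expect (PMF.pure x) f = f x := by
  rw [expect, tsum_eq_single x]
  · simp
  · intro y hy
    simp [PMF.pure_apply, hy]

theorem expect_map (D : PMF X) {φ : X → Y} (hφ : Function.Injective φ) (f : Y → ℝ) :
    expect (D.map φ) f = expect D (fun x => f (φ x)) := by
  have h1 : ∀ x, D.map φ (φ x) = D x := by
    intro x
    rw [PMF.map_apply, tsum_eq_single x]
    · simp
    · intro y hy
      rw [if_neg fun h => hy (hφ h).symm]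
  rw [expect, ← hφ.tsum_eq]
  · simp only [h1]
    rfl
  · intro y hy
    by_contra hn
    refine hy ?_
    have : y ∉ (D.map φ).support := by
      rw [PMF.support_map]
      rintro ⟨x, -, rfl⟩
      exact hn ⟨x, rfl⟩
    simp [(PMF.apply_eq_zero_iff _ y).2 this]

theorem expect_uniformOfFinset_bind {B : Finset Y} (hB : B.Nonempty) (D : Y → PMF X)
    (hD : ∀ i ∈ B, (D i).support.Finite) (f : X → ℝ) :
    expect ((PMF.uniformOfFinset B hB).bind D) f = (∑ i ∈ B, expect (D i) f) / B.card := by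
  classical
  have h : ∀ x, (((PMF.uniformOfFinset B hB).bind D) x).toReal =
      (B.card : ℝ)⁻¹ * ∑ i ∈ B, (D i x).toReal := by
    intro x
    rw [PMF.bind_apply, tsum_eq_sum (s := B), ENNReal.toReal_sum, Finset.mul_sum]
    · refine Finset.sum_congr rfl fun i hi => ?_
      simp [PMF.uniformOfFinset_apply, hi]
    · intro i hi
      exact ENNReal.mul_ne_top (PMF.apply_ne_top _ _) (PMF.apply_ne_top _ _)
    · intro i hi
      simp [PMF.uniformOfFinset_apply, hi]
  simp only [expect, h, mul_assoc, Finset.sum_mul]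
  rw [tsum_mul_left, Summable.tsum_finsetSum fun i hi => summable_toReal_mul (hD i hi) f,
    div_eq_inv_mul]

theorem expect_eq_sum {D : PMF X} (hD : D.support.Finite) (f : X → ℝ) :
    expect D f = ∑ x ∈ hD.toFinset, (D x).toReal * f x := by
  rw [expect, tsum_eq_sum]
  intro x hx
  have : x ∉ D.support := by simpa using hx
  simp [(D.apply_eq_zero_iff x).2 this]

end Expect

/-! ### Randomized algorithms -/

section Algorithms

variable {S : Setup}

theorem exists_price_le (S : Setup) : ∃ M : ℝ, 0 ≤ M ∧ ∀ i j, (S.P i).r j ≤ M := by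
  refine ⟨∑ i, ∑ j, (S.P i).r j, Finset.sum_nonneg fun i _ => Finset.sum_nonneg fun j _ =>
    ((S.P i).r_pos j).le, fun i j => ?_⟩
  have h1 : (S.P i).r j ≤ ∑ j, (S.P i).r j :=
    Finset.single_le_sum (fun j _ => ((S.P i).r_pos j).le) (Finset.mem_univ j)
  exact h1.trans (Finset.single_le_sum (f := fun i => ∑ j, (S.P i).r j)
    (fun i _ => Finset.sum_nonneg fun j _ => ((S.P i).r_pos j).le) (Finset.mem_univ i))

theorem Policy.revenueFrom_mem_Icc (σ : Policy S) {M : ℝ} (hM : ∀ i j, (S.P i).r j ≤ M)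
    (hM0 : 0 ≤ M) (A : ArrivalSeq S) (inv : Fin S.n → ℕ) (h : List (Event S)) :
    σ.revenueFrom inv h A ∈ Set.Icc 0 (A.length * M) := by
  induction A generalizing inv h with
  | nil => simp [Policy.revenueFrom]
  | cons c A ih =>
    rw [Policy.revenueFrom, List.length_cons, Nat.cast_succ, add_mul, one_mul]
    split
    · exact ⟨(ih _ _).1, by linarith [(ih inv (⟨c, none, false⟩ :: h)).2]⟩
    · rename_i o _
      split_ifs
      · have h1 := ih (Function.update inv o.1 (inv o.1 - 1)) (⟨c, some o, true⟩ :: h)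
        have h2 := ih inv (⟨c, some o, false⟩ :: h)
        have p0 := (c o.1 o.2).2.1
        have p1 := (c o.1 o.2).2.2
        have r0 := (S.P o.1).r_pos o.2
        have r1 := hM o.1 o.2
        constructor
        · exact add_nonneg (mul_nonneg p0 (by linarith [h1.1]))
            (mul_nonneg (by linarith) h2.1)
        · have e1 := mul_le_mul_of_nonneg_left (add_le_add r1 h1.2) p0
          have e2 : (1 - (c o.1 o.2 : ℝ)) * σ.revenueFrom inv (⟨c, some o, false⟩ :: h) A ≤
              (1 - (c o.1 o.2 : ℝ)) * (M + A.length * M) :=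
            mul_le_mul_of_nonneg_left (by linarith [h2.2]) (by linarith)
          linarith
      · exact ⟨(ih _ _).1, by linarith [(ih inv (⟨c, none, false⟩ :: h)).2]⟩

theorem OnlineAlgorithm.measurable_revenueFrom (alg : OnlineAlgorithm S) (A : ArrivalSeq S)
    (inv : Fin S.n → ℕ) (h : List (Event S)) :
    Measurable fun ω => (alg.policy ω).revenueFrom inv h A := by
  induction A generalizing inv h with
  | nil => simp [Policy.revenueFrom]
  | cons c A ih =>
    let _ : MeasurableSpace (Option (Offer S)) := ⊤
    have hpol : Measurable fun ω => alg.policy ω h c :=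
      measurable_to_countable' fun o => alg.measurableSet_policy h c o
    -- The revenue is a function of the seed and of one of the finitely many possible offers.
    have key : Measurable fun p : Option (Offer S) × alg.Seed => match p.1 with
        | none => (alg.policy p.2).revenueFrom inv (⟨c, none, false⟩ :: h) A
        | some o =>
          if 0 < inv o.1 then
            (c o.1 o.2 : ℝ) * ((S.P o.1).r o.2 + (alg.policy p.2).revenueFrom
                (Function.update inv o.1 (inv o.1 - 1)) (⟨c, some o, true⟩ :: h) A) +
              (1 - (c o.1 o.2 : ℝ)) *
                (alg.policy p.2).revenueFrom inv (⟨c, some o, false⟩ :: h) A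
          else (alg.policy p.2).revenueFrom inv (⟨c, none, false⟩ :: h) A := by
      refine measurable_from_prod_countable_right fun o => ?_
      rcases o with _ | o
      · exact ih _ _
      · dsimp only
        split_ifs
        · exact (((ih _ _).const_add _).const_mul _).add ((ih _ _).const_mul _)
        · exact ih _ _
    exact key.comp (hpol.prodMk measurable_id)

theorem OnlineAlgorithm.integrable_revenueFrom (alg : OnlineAlgorithm S) (A : ArrivalSeq S) :
    Integrable (fun ω => (alg.policy ω).revenueFrom S.k [] A) alg.law := by
  obtain ⟨M, hM0, hM⟩ := exists_price_le S
  refine Integrable.of_bound (alg.measurable_revenueFrom A S.k []).aestronglyMeasurable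
    (A.length * M) (Filter.Eventually.of_forall fun ω => ?_)
  have h := (alg.policy ω).revenueFrom_mem_Icc hM hM0 A S.k []
  rw [Real.norm_of_nonneg h.1]
  exact h.2

/-- The easy half of Yao's principle: against a random arrival sequence, no randomized algorithm
beats a bound that holds for all deterministic policies. -/
theorem OnlineAlgorithm.expect_expectedRevenue_le (alg : OnlineAlgorithm S)
    {D : PMF (ArrivalSeq S)} (hD : D.support.Finite) {b : ℝ}
    (hb : ∀ σ : Policy S, expect D (σ.revenueFrom S.k []) ≤ b) :
    expect D alg.expectedRevenue ≤ b := by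
  have hint : ∀ A ∈ hD.toFinset, Integrable
      (fun ω => (D A).toReal * (alg.policy ω).revenueFrom S.k [] A) alg.law :=
    fun A _ => (alg.integrable_revenueFrom A).const_mul _
  calc expect D alg.expectedRevenue
      = ∫ ω, expect D ((alg.policy ω).revenueFrom S.k []) ∂alg.law := by
        simp only [expect_eq_sum hD]
        rw [integral_finsetSum _ hint]
        exact Finset.sum_congr rfl fun A _ => (integral_const_mul _ _).symm
    _ ≤ ∫ _, b ∂alg.law := by
        refine integral_mono ?_ (integrable_const b) fun ω => hb _
        simp only [expect_eq_sum hD]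
        exact integrable_finsetSum _ hint
    _ = b := by simp

end Algorithms

/-! ### Lower bounds on the linear program -/

section LinearProgram

variable {S : Setup}

/-- `v` is the value of a feasible solution of the linear program with capacities `cap` in place
of the starting inventories. -/
def IsLPValue (cap : Fin S.n → ℝ) (A : ArrivalSeq S) (v : ℝ) : Prop :=
  ∃ x : Fin A.length → (i : Fin S.n) → Fin (S.P i).m → ℝ,
    (∀ t i j, 0 ≤ x t i j) ∧
    (∀ i, ∑ t, ∑ j, (A.get t i j : ℝ) * x t i j ≤ cap i) ∧
    (∀ t, ∑ i, ∑ j, x t i j ≤ 1) ∧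
    v = ∑ t, ∑ i, ∑ j, (A.get t i j : ℝ) * (S.P i).r j * x t i j

theorem IsLPValue.nil {cap : Fin S.n → ℝ} (hcap : ∀ i, 0 ≤ cap i) :
    IsLPValue cap ([] : ArrivalSeq S) 0 :=
  ⟨fun _ _ _ => 0, by simp, by simpa using hcap, by simp, by simp⟩

theorem sum_mul_single_single (f : (i : Fin S.n) → Fin (S.P i).m → ℝ) (i₀ : Fin S.n)
    (j₀ : Fin (S.P i₀).m) :
    ∑ i, ∑ j, f i j * (Pi.single i₀ (Pi.single j₀ 1) : (i : Fin S.n) → Fin (S.P i).m → ℝ) i j =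
      f i₀ j₀ := by
  rw [Finset.sum_eq_single i₀, Finset.sum_eq_single j₀]
  · simp
  · intro j _ hj
    simp [hj]
  · simp
  · intro i _ hi
    simp [hi]
  · simp

theorem IsLPValue.cons {cap : Fin S.n → ℝ} {A : ArrivalSeq S} {v : ℝ} (h : IsLPValue cap A v)
    {c : Customer S} {i₀ : Fin S.n} {j₀ : Fin (S.P i₀).m} (hc : c i₀ j₀ = 1) :
    IsLPValue (cap + Pi.single i₀ 1) (c :: A) ((S.P i₀).r j₀ + v) := by
  obtain ⟨x, h0, h1, h2, rfl⟩ := h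
  set s : (i : Fin S.n) → Fin (S.P i).m → ℝ := Pi.single i₀ (Pi.single j₀ 1) with hs
  have s0 : 0 ≤ s := Pi.single_nonneg.2 (Pi.single_nonneg.2 zero_le_one)
  refine ⟨Fin.cons (α := fun _ => (i : Fin S.n) → Fin (S.P i).m → ℝ) s x, ?_, ?_, ?_, ?_⟩
  · intro t
    refine Fin.cases ?_ (fun t => ?_) t
    · exact fun i j => s0 i j
    · exact h0 t
  · intro i
    refine (Fin.sum_univ_succ _).trans_le ?_
    rw [add_comm]
    refine add_le_add (h1 i) ?_
    change ∑ j, (c i j : ℝ) * s i j ≤ _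
    rcases eq_or_ne i i₀ with rfl | hi
    · rw [hs, Pi.single_eq_same, Finset.sum_eq_single j₀]
      · simp [hc]
      · intro j _ hj
        simp [hj]
      · simp
    · simp [hs, hi]
  · intro t
    refine Fin.cases ?_ (fun t => ?_) t
    · change ∑ i, ∑ j, s i j ≤ 1
      simpa using (sum_mul_single_single (fun _ _ => 1) i₀ j₀).le
    · exact h2 t
  · refine Eq.symm ((Fin.sum_univ_succ _).trans (congrArg₂ (· + ·) ?_ rfl))
    refine (sum_mul_single_single (fun i j => (c i j : ℝ) * (S.P i).r j) i₀ j₀).trans ?_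
    simp [hc]

theorem IsLPValue.replicate_append {cap : Fin S.n → ℝ} {A : ArrivalSeq S} {v : ℝ}
    (h : IsLPValue cap A v) {c : Customer S} {i₀ : Fin S.n} {j₀ : Fin (S.P i₀).m}
    (hc : c i₀ j₀ = 1) (k : ℕ) :
    IsLPValue (cap + Pi.single i₀ (k : ℝ)) (List.replicate k c ++ A)
      (k * (S.P i₀).r j₀ + v) := by
  induction k with
  | zero => simpa using h
  | succ k ih =>
    have e1 : cap + Pi.single i₀ ((k + 1 : ℕ) : ℝ) =
        cap + Pi.single i₀ (k : ℝ) + Pi.single i₀ 1 := by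
      rw [add_assoc, ← Pi.single_add, Nat.cast_succ]
    have e2 : ((k + 1 : ℕ) : ℝ) * (S.P i₀).r j₀ + v =
        (S.P i₀).r j₀ + (k * (S.P i₀).r j₀ + v) := by
      push_cast
      ring
    rw [e1, e2]
    exact ih.cons hc

theorem bddAbove_lpValues (A : ArrivalSeq S) : BddAbove (lpValues A) := by
  refine ⟨∑ _t : Fin A.length, ∑ i, ∑ j, (S.P i).r j, ?_⟩
  rintro _ ⟨x, h0, -, h2, rfl⟩
  refine Finset.sum_le_sum fun t _ => Finset.sum_le_sum fun i _ => Finset.sum_le_sum fun j _ => ?_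
  have x1 : x t i j ≤ 1 := by
    refine le_trans ?_ (h2 t)
    refine (Finset.single_le_sum (f := fun j => x t i j) (fun j _ => h0 t i j)
      (Finset.mem_univ j)).trans ?_
    exact Finset.single_le_sum (f := fun i => ∑ j, x t i j)
      (fun i _ => Finset.sum_nonneg fun j _ => h0 t i j) (Finset.mem_univ i)
  have r0 := (S.P i).r_pos j
  have p0 := (A.get t i j).2.1
  have p1 := (A.get t i j).2.2
  calc (A.get t i j : ℝ) * (S.P i).r j * x t i j
      ≤ (A.get t i j : ℝ) * (S.P i).r j * 1 :=
        mul_le_mul_of_nonneg_left x1 (mul_nonneg p0 r0.le)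
    _ ≤ (S.P i).r j := by nlinarith

theorem IsLPValue.le_OPT {A : ArrivalSeq S} {v : ℝ} (h : IsLPValue (fun i => (S.k i : ℝ)) A v) :
    v ≤ OPT A :=
  le_csSup (bddAbove_lpValues A) h

end LinearProgram

/-! ### The random arrival sequence -/

section Arrivals

variable {S : Setup}

/-- The customer with valuation `v` for each item in `B`, and no interest in the other items: she
buys an item of `B` at every price up to `v`. -/
noncomputable def valuationCustomer (S : Setup) (B : Finset (Fin S.n)) (v : ℝ) : Customer S :=
  fun i j => if i ∈ B ∧ (S.P i).r j ≤ v then 1 else 0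

/-- The hard distribution over arrival sequences, for `y` items in demand forming the set `B`:
`k` customers with valuation `v y` for the items in `B`, after which a uniformly random item of
`B` falls out of demand and the process goes on with `y - 1` items. It is meant for
`B.card = y`. -/
noncomputable def arrivals (S : Setup) (k : ℕ) (v : ℕ → ℝ) :
    ℕ → Finset (Fin S.n) → PMF (ArrivalSeq S)
  | 0, _ => PMF.pure []
  | y + 1, B =>
    if hB : B.Nonempty then
      (PMF.uniformOfFinset B hB).bind fun i =>
        (arrivals S k v y (B.erase i)).map
          (List.replicate k (valuationCustomer S B (v (y + 1))) ++ ·)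
    else PMF.pure []

theorem mem_support_arrivals_succ {k : ℕ} {v : ℕ → ℝ} {y : ℕ} {B : Finset (Fin S.n)}
    (hB : B.Nonempty) {A : ArrivalSeq S} :
    A ∈ (arrivals S k v (y + 1) B).support ↔
      ∃ i ∈ B, ∃ A' ∈ (arrivals S k v y (B.erase i)).support,
        List.replicate k (valuationCustomer S B (v (y + 1))) ++ A' = A := by
  rw [arrivals, dif_pos hB, PMF.mem_support_bind_iff]
  simp [PMF.support_map]

theorem finite_support_arrivals (S : Setup) (k : ℕ) (v : ℕ → ℝ) (y : ℕ) (B : Finset (Fin S.n)) :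
    (arrivals S k v y B).support.Finite := by
  induction y generalizing B with
  | zero => simp [arrivals]
  | succ y ih =>
    rw [arrivals]
    split_ifs with hB
    · rw [PMF.support_bind, PMF.support_uniformOfFinset]
      refine B.finite_toSet.biUnion fun i _ => ?_
      rw [PMF.support_map]
      exact (ih _).image _
    · simp

theorem isDeterministic_of_mem_support_arrivals {k : ℕ} {v : ℕ → ℝ} {y : ℕ}
    {B : Finset (Fin S.n)} {A : ArrivalSeq S} (hA : A ∈ (arrivals S k v y B).support) :
    A.IsDeterministic := by
  induction y generalizing B A with
  | zero =>
    obtain rfl : A = [] := by simpa [arrivals] using hA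
    simp [ArrivalSeq.IsDeterministic]
  | succ y ih =>
    rcases B.eq_empty_or_nonempty with rfl | hB
    · obtain rfl : A = [] := by simpa [arrivals] using hA
      simp [ArrivalSeq.IsDeterministic]
    · obtain ⟨i, -, A', hA', rfl⟩ := (mem_support_arrivals_succ hB).1 hA
      intro c hc
      rcases List.mem_append.1 hc with h | h
      · rw [List.eq_of_mem_replicate h]
        intro i j
        rw [valuationCustomer]
        split_ifs <;> simp
      · exact ih hA' c h

/-- In hindsight, the item that falls out of demand when `z` items are left can be sold out to
the `k` customers who arrive just before. -/
theorem isLPValue_arrivals {k : ℕ} {v : ℕ → ℝ} {y : ℕ}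
    (hv : ∀ z, 1 ≤ z → z ≤ y → ∀ i, ∃ j, (S.P i).r j = v z)
    {B : Finset (Fin S.n)} (hB : B.card = y) {A : ArrivalSeq S}
    (hA : A ∈ (arrivals S k v y B).support) :
    IsLPValue (fun i => if i ∈ B then (k : ℝ) else 0) A
      (k * ∑ z ∈ Finset.range y, v (z + 1)) := by
  induction y generalizing B A with
  | zero =>
    obtain rfl : A = [] := by simpa [arrivals] using hA
    simp only [Finset.range_zero, Finset.sum_empty, mul_zero]
    exact IsLPValue.nil fun i => by positivity
  | succ y ih =>
    have hne : B.Nonempty := Finset.card_pos.1 (by omega)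
    obtain ⟨i, hi, A', hA', rfl⟩ := (mem_support_arrivals_succ hne).1 hA
    obtain ⟨j, hj⟩ := hv (y + 1) (by omega) le_rfl i
    have h := ih (fun z h1 h2 => hv z h1 (by omega))
      (by rw [Finset.card_erase_of_mem hi, hB, Nat.add_sub_cancel]) hA'
    have hc : valuationCustomer S B (v (y + 1)) i j = 1 := by
      rw [valuationCustomer, if_pos ⟨hi, hj.le⟩]
    convert h.replicate_append hc k using 1
    · funext l
      rcases eq_or_ne l i with rfl | hl
      · simp [hi]
      · simp [hl]
    · rw [Finset.sum_range_succ, hj]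
      ring

theorem le_expect_OPT_arrivals {k : ℕ} (hk : ∀ i, S.k i = k) {v : ℕ → ℝ}
    (hv : ∀ z, 1 ≤ z → z ≤ S.n → ∀ i, ∃ j, (S.P i).r j = v z) :
    k * ∑ z ∈ Finset.range S.n, v (z + 1) ≤
      expect (arrivals S k v S.n Finset.univ) OPT := by
  rw [← expect_const (arrivals S k v S.n Finset.univ) (k * ∑ z ∈ Finset.range S.n, v (z + 1))]
  refine expect_mono (finite_support_arrivals S k v _ _) fun A hA => IsLPValue.le_OPT ?_
  simpa [hk] using isLPValue_arrivals hv (Finset.card_fin _) hA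

/-- Serving one customer with valuation `v` for the items in `B`: the revenue is earned from at
most one item of `B`, and is at most `v`. It is compared here with the value of the inventory it
uses, when an average unit of the items in `B` is worth `lam`. -/
theorem Policy.exists_revenueFrom_cons (σ : Policy S) {lam : ℝ} (B : Finset (Fin S.n)) (v : ℝ)
    (inv : Fin S.n → ℕ) (h : List (Event S)) :
    ∃ (g : ℝ) (inv' : Fin S.n → ℕ) (h' : List (Event S)),
      (∀ A, σ.revenueFrom inv h (valuationCustomer S B v :: A) = g + σ.revenueFrom inv' h' A) ∧
      g + lam / B.card * ∑ i ∈ B, (inv' i : ℝ) ≤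
        lam / B.card * ∑ i ∈ B, (inv i : ℝ) + max (v - lam / B.card) 0 := by
  set c := valuationCustomer S B v with hc
  have hmax := le_max_right (v - lam / B.card) 0
  rcases ho : σ h c with _ | o
  · refine ⟨0, inv, ⟨c, none, false⟩ :: h, fun A => ?_, by linarith⟩
    simp [Policy.revenueFrom, ho]
  by_cases hinv : 0 < inv o.1
  · by_cases hbuy : o.1 ∈ B ∧ (S.P o.1).r o.2 ≤ v
    · have hc1 : c o.1 o.2 = 1 := by rw [hc, valuationCustomer, if_pos hbuy]
      refine ⟨(S.P o.1).r o.2, Function.update inv o.1 (inv o.1 - 1), ⟨c, some o, true⟩ :: h,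
        fun A => ?_, ?_⟩
      · simp [Policy.revenueFrom, ho, hinv, hc1]
      · have hsum : ∑ i ∈ B, ((Function.update inv o.1 (inv o.1 - 1) i : ℕ) : ℝ) =
            ∑ i ∈ B, (inv i : ℝ) - 1 := by
          rw [← Finset.add_sum_erase B _ hbuy.1,
            ← Finset.add_sum_erase B (fun i => (inv i : ℝ)) hbuy.1, Function.update_self,
            Nat.cast_pred hinv, Finset.sum_congr rfl fun i hi => by
              rw [Function.update_of_ne (Finset.ne_of_mem_erase hi)]]
          ring
        rw [hsum, mul_sub, mul_one]
        linarith [le_max_left (v - lam / B.card) 0, hbuy.2]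
    · have hc0 : c o.1 o.2 = 0 := by rw [hc, valuationCustomer, if_neg hbuy]
      refine ⟨0, inv, ⟨c, some o, false⟩ :: h, fun A => ?_, by linarith⟩
      simp [Policy.revenueFrom, ho, hinv, hc0]
  · refine ⟨0, inv, ⟨c, none, false⟩ :: h, fun A => ?_, by linarith⟩
    simp [Policy.revenueFrom, ho, hinv]

theorem Policy.exists_revenueFrom_replicate (σ : Policy S) {lam : ℝ} (B : Finset (Fin S.n))
    (v : ℝ) (q : ℕ) (inv : Fin S.n → ℕ) (h : List (Event S)) :
    ∃ (g : ℝ) (inv' : Fin S.n → ℕ) (h' : List (Event S)),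
      (∀ A, σ.revenueFrom inv h (List.replicate q (valuationCustomer S B v) ++ A) =
        g + σ.revenueFrom inv' h' A) ∧
      g + lam / B.card * ∑ i ∈ B, (inv' i : ℝ) ≤
        lam / B.card * ∑ i ∈ B, (inv i : ℝ) + q * max (v - lam / B.card) 0 := by
  induction q generalizing inv h with
  | zero => exact ⟨0, inv, h, by simp, by simp⟩
  | succ q ih =>
    obtain ⟨g₁, inv₁, h₁, e₁, b₁⟩ := σ.exists_revenueFrom_cons (lam := lam) B v inv h
    obtain ⟨g₂, inv₂, h₂, e₂, b₂⟩ := ih inv₁ h₁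
    refine ⟨g₁ + g₂, inv₂, h₂, fun A => ?_, ?_⟩
    · rw [List.replicate_succ, List.cons_append, e₁, e₂, add_assoc]
    · push_cast
      linarith

/-- Removing a uniformly random element of `B` does not change the expected average of `f` over
`B`, except that an average over the empty set counts as `0`. -/
theorem sum_erase_average_le {ι : Type} [DecidableEq ι] {B : Finset ι} (hB : B.Nonempty)
    {lam : ℝ} (hlam : 0 ≤ lam) {f : ι → ℝ} (hf : ∀ i, 0 ≤ f i) :
    (∑ i ∈ B, lam / (B.erase i).card * ∑ l ∈ B.erase i, f l) / B.card ≤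
      lam / B.card * ∑ l ∈ B, f l := by
  obtain ⟨y, hy⟩ : ∃ y, B.card = y + 1 := ⟨B.card - 1, by have := hB.card_pos; omega⟩
  have h1 : ∑ i ∈ B, lam / (B.erase i).card * ∑ l ∈ B.erase i, f l =
      lam / y * (y * ∑ l ∈ B, f l) := by
    have h2 : ∀ i ∈ B, lam / (B.erase i).card * ∑ l ∈ B.erase i, f l =
        lam / y * (∑ l ∈ B, f l - f i) := by
      intro i hi
      rw [Finset.card_erase_of_mem hi, hy, Nat.add_sub_cancel, Finset.sum_erase_eq_sub hi]
    rw [Finset.sum_congr rfl h2, ← Finset.mul_sum, Finset.sum_sub_distrib, Finset.sum_const, hy]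
    simp only [nsmul_eq_mul]
    push_cast
    ring
  have h3 : 0 ≤ ∑ l ∈ B, f l := Finset.sum_nonneg fun i _ => hf i
  rw [h1, hy, div_mul_eq_mul_div, div_mul_eq_mul_div]
  refine div_le_div_of_nonneg_right ?_ (by positivity)
  rcases Nat.eq_zero_or_pos y with rfl | hy0
  · simpa using mul_nonneg hlam h3
  · have : (y : ℝ) ≠ 0 := by positivity
    exact (by field_simp : lam * (y * ∑ l ∈ B, f l) / y = lam * ∑ l ∈ B, f l).le

/-- The upper bound on every policy: `lam` is the multiplier of the constraint that an item which
stays in demand to the end is not oversold. With `z` items in demand, a sale uses `1 / z` units of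
such an item on average, so it is worth at most `v z - lam / z` beyond the inventory used. -/
theorem Policy.expect_revenueFrom_arrivals_le (σ : Policy S) {lam : ℝ} (hlam : 0 ≤ lam) (k : ℕ)
    (v : ℕ → ℝ) {y : ℕ} {B : Finset (Fin S.n)} (hB : B.card = y) (inv : Fin S.n → ℕ)
    (h : List (Event S)) :
    expect (arrivals S k v y B) (σ.revenueFrom inv h) ≤
      lam / B.card * ∑ i ∈ B, (inv i : ℝ) +
        k * ∑ z ∈ Finset.range y, max (v (z + 1) - lam / ((z : ℝ) + 1)) 0 := by
  induction y generalizing B inv h with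
  | zero =>
    rw [arrivals, expect_pure, hB]
    simp [Policy.revenueFrom]
  | succ y ih =>
    have hne : B.Nonempty := Finset.card_pos.1 (by omega)
    obtain ⟨g, inv', h', e, b⟩ :=
      σ.exists_revenueFrom_replicate (lam := lam) B (v (y + 1)) k inv h
    set R : ℝ := k * ∑ z ∈ Finset.range y, max (v (z + 1) - lam / ((z : ℝ) + 1)) 0 with hR
    have hcard : (0 : ℝ) < B.card := by exact_mod_cast hne.card_pos
    have hstep : ∀ i ∈ B, expect ((arrivals S k v y (B.erase i)).map
        (List.replicate k (valuationCustomer S B (v (y + 1))) ++ ·)) (σ.revenueFrom inv h) ≤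
        lam / (B.erase i).card * ∑ l ∈ B.erase i, (inv' l : ℝ) + (g + R) := by
      intro i hi
      rw [expect_map _ (List.append_right_injective _)]
      simp only [e]
      rw [expect_add (finite_support_arrivals S k v y _), expect_const]
      have := ih (B := B.erase i)
        (by rw [Finset.card_erase_of_mem hi, hB, Nat.add_sub_cancel]) inv' h'
      linarith
    rw [arrivals, dif_pos hne, expect_uniformOfFinset_bind hne]
    · calc _ ≤ (∑ i ∈ B, (lam / (B.erase i).card * ∑ l ∈ B.erase i, (inv' l : ℝ) + (g + R)))
            / B.card := div_le_div_of_nonneg_right (Finset.sum_le_sum hstep) hcard.le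
        _ = (∑ i ∈ B, lam / (B.erase i).card * ∑ l ∈ B.erase i, (inv' l : ℝ)) / B.card
            + (g + R) := by
          rw [Finset.sum_add_distrib, Finset.sum_const, nsmul_eq_mul, add_div,
            mul_div_cancel_left₀ _ hcard.ne']
        _ ≤ lam / B.card * ∑ l ∈ B, (inv' l : ℝ) + (g + R) := by
          gcongr
          exact sum_erase_average_le hne hlam fun i => Nat.cast_nonneg _
        _ ≤ lam / B.card * ∑ i ∈ B, (inv i : ℝ) + k * max (v (y + 1) - lam / B.card) 0 + R := by
          linarith
        _ = _ := by
          rw [Finset.sum_range_succ, hB, hR]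
          push_cast
          ring
    · intro i _
      rw [PMF.support_map]
      exact (finite_support_arrivals S k v y _).image _

theorem OnlineAlgorithm.expect_expectedRevenue_arrivals_le (alg : OnlineAlgorithm S) {lam : ℝ}
    (hlam : 0 ≤ lam) {k : ℕ} (hk : ∀ i, S.k i = k) (v : ℕ → ℝ) :
    expect (arrivals S k v S.n Finset.univ) alg.expectedRevenue ≤
      k * (lam + ∑ z ∈ Finset.range S.n, max (v (z + 1) - lam / ((z : ℝ) + 1)) 0) := by
  refine alg.expect_expectedRevenue_le (finite_support_arrivals S k v _ _) fun σ => ?_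
  refine (σ.expect_revenueFrom_arrivals_le hlam k v (Finset.card_fin _) S.k []).trans_eq ?_
  have hn : (S.n : ℝ) ≠ 0 := by exact_mod_cast S.n_pos.ne'
  simp only [hk, Finset.sum_const, Finset.card_univ, Fintype.card_fin, nsmul_eq_mul]
  field_simp

end Arrivals

/-! ### The choice of the valuations -/

/-- A Riemann sum estimate: the sum is close to the integral of `r - M / t` over the interval
from `M / r`, where the integrand vanishes, to `exp α * (M / r)`. -/
theorem sum_max_sub_div_le {M r α : ℝ} (hM : 0 < M) (hr : 0 < r) (hα : 0 ≤ α) {K : ℕ}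
    (hK : r * K ≤ M * Real.exp α) :
    ∑ z ∈ Finset.range K, max (r - M / ((z : ℝ) + 1)) 0 ≤ M * (Real.exp α - 1 - α) + r := by
  set a : ℝ := M / r with ha
  have ha0 : 0 < a := div_pos hM hr
  have hra : r * a = M := mul_div_cancel₀ M hr.ne'
  -- `G` is a primitive of `r - M / t`, and is increasing from `a` on.
  set G : ℝ → ℝ := fun t => r * t - M * Real.log t with hG
  have hlog : ∀ s t : ℝ, 0 < s → 0 < t → Real.log t - Real.log s ≤ (t - s) / s := by
    intro s t hs ht
    rw [← Real.log_div ht.ne' hs.ne', sub_div, div_self hs.ne']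
    exact Real.log_le_sub_one_of_pos (div_pos ht hs)
  have hinc : ∀ s t : ℝ, 0 < s → 0 < t → (r - M / s) * (t - s) ≤ G t - G s := by
    intro s t hs ht
    have h1 := mul_le_mul_of_nonneg_left (hlog s t hs ht) hM.le
    have h2 : (r - M / s) * (t - s) = r * t - r * s - M * ((t - s) / s) := by
      field_simp
    simp only [hG]
    linarith
  have hslope : ∀ s : ℝ, a ≤ s → 0 ≤ r - M / s := by
    intro s hs
    rw [sub_nonneg, div_le_iff₀ (ha0.trans_le hs), ← hra]
    exact mul_le_mul_of_nonneg_left hs hr.le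
  have hmono : ∀ s t : ℝ, a ≤ s → s ≤ t → G s ≤ G t := by
    intro s t hs hst
    have hs0 := ha0.trans_le hs
    have := mul_nonneg (hslope s hs) (sub_nonneg.2 hst)
    linarith [hinc s t hs0 (hs0.trans_le hst)]
  have hterm : ∀ z : ℕ, max (r - M / ((z : ℝ) + 1)) 0 ≤
      G (max (((z + 1 : ℕ) : ℝ) + 1) a) - G (max ((z : ℝ) + 1) a) := by
    intro z
    push_cast
    have hz : (0 : ℝ) < (z : ℝ) + 1 := by positivity
    refine max_le ?_ ?_
    · rcases le_total a ((z : ℝ) + 1) with h | h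
      · rw [max_eq_left h, max_eq_left (by linarith)]
        have := hinc ((z : ℝ) + 1) ((z : ℝ) + 1 + 1) hz (by linarith)
        linarith
      · have h1 : r - M / ((z : ℝ) + 1) ≤ 0 := by
          rw [sub_nonpos, le_div_iff₀ hz, ← hra]
          exact mul_le_mul_of_nonneg_left h hr.le
        rw [max_eq_right h]
        linarith [hmono a _ le_rfl (le_max_right ((z : ℝ) + 1 + 1) a)]
    · rw [sub_nonneg]
      exact hmono _ _ (le_max_right _ _) (max_le_max_right _ (by linarith))
  have hexp : 1 ≤ Real.exp α := Real.one_le_exp hα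
  set t : ℝ := a * Real.exp α + 1 with ht
  have hat : a * Real.exp α ≤ t := by linarith
  have haexp : a ≤ a * Real.exp α := le_mul_of_one_le_right ha0.le hexp
  have hKt : (K : ℝ) + 1 ≤ t := by
    have : (K : ℝ) ≤ a * Real.exp α := by
      rw [ha, div_mul_eq_mul_div, le_div_iff₀ hr]
      linarith
    linarith
  have hlogt : Real.log a + α ≤ Real.log t := by
    have h := Real.log_le_log (by positivity) hat
    rwa [Real.log_mul ha0.ne' (Real.exp_pos α).ne', Real.log_exp] at h
  calc ∑ z ∈ Finset.range K, max (r - M / ((z : ℝ) + 1)) 0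
      ≤ ∑ z ∈ Finset.range K,
          (G (max (((z + 1 : ℕ) : ℝ) + 1) a) - G (max ((z : ℝ) + 1) a)) :=
        Finset.sum_le_sum fun z _ => hterm z
    _ = G (max ((K : ℝ) + 1) a) - G (max (((0 : ℕ) : ℝ) + 1) a) :=
        Finset.sum_range_sub (fun z : ℕ => G (max ((z : ℝ) + 1) a)) K
    _ ≤ G t - G a :=
        sub_le_sub (hmono _ _ (le_max_right _ _) (max_le hKt (haexp.trans hat)))
          (hmono _ _ le_rfl (le_max_right _ _))
    _ ≤ M * (Real.exp α - 1 - α) + r := by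
        have h1 := mul_le_mul_of_nonneg_left hlogt hM.le
        have h2 : r * t = M * Real.exp α + r := by rw [ht, ← hra]; ring
        simp only [hG]
        linarith

namespace PriceSet

variable (P : PriceSet)

theorem isBookingLimits_bookingLimits : P.IsBookingLimits P.bookingLimits :=
  P.existsUnique_bookingLimits.choose_spec.1

theorem F_pos : 0 < P.F := by
  have := Real.exp_lt_one_iff.2 (neg_lt_zero.2 (P.isBookingLimits_bookingLimits.1 P.first))
  rw [F]
  linarith

theorem F_lt_one : P.F < 1 := by
  rw [F]
  linarith [Real.exp_pos (-P.bookingLimits P.first)]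

theorem prev_nonneg (j : Fin P.m) : 0 ≤ P.prev j := by
  rw [prev]
  split_ifs
  exacts [le_rfl, (P.r_pos _).le]

theorem prev_lt (j : Fin P.m) : P.prev j < P.r j := by
  have := (P.coef_mem j).1
  rw [sub_pos, div_lt_one (P.r_pos j)] at this
  exact this

theorem r_mul_exp_neg_bookingLimits (j : Fin P.m) :
    P.r j * Real.exp (-P.bookingLimits j) = P.r j - P.F * (P.r j - P.prev j) := by
  have h := P.isBookingLimits_bookingLimits.2.2 j
  have hr := (P.r_pos j).ne'
  have hc := (P.coef_mem j).1.ne'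
  rw [F, ← h]
  have hd : P.r j - P.prev j ≠ 0 := (sub_pos.2 (P.prev_lt j)).ne'
  have h1 : 1 - P.prev j / P.r j = (P.r j - P.prev j) / P.r j := by
    field_simp
  rw [h1]
  field_simp
  ring

theorem sum_Iic_r_sub_prev (q : Fin P.m) : ∑ j ∈ Finset.Iic q, (P.r j - P.prev j) = P.r q := by
  obtain ⟨q, hq⟩ := q
  induction q with
  | zero =>
    have : Finset.Iic (⟨0, hq⟩ : Fin P.m) = {⟨0, hq⟩} := by
      ext j
      simp [Fin.le_def, Fin.ext_iff]
    rw [this, Finset.sum_singleton]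
    simp [prev]
  | succ q ih =>
    have : Finset.Iic (⟨q + 1, hq⟩ : Fin P.m) =
        insert ⟨q + 1, hq⟩ (Finset.Iic ⟨q, by omega⟩) := by
      ext j
      simp only [Finset.mem_Iic, Finset.mem_insert, Fin.le_def, Fin.ext_iff]
      omega
    rw [this, Finset.sum_insert (by simp [Fin.le_def]), ih]
    simp [prev]

/-- The valuations of the hard instance. With `M` as the multiplier, a sale at price `r` while
`y` items are in demand is worth more than the inventory it uses if `M < r * y`. The customers
who come while `y` items are in demand value them at the highest price `r j` such that
`r j * y ≤ M * exp (α j)`. A good policy then sells along every price `r j` from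
`y = exp (α j) * (M / r j)` down to `y = M / r j`. The two bounds are those on the optimum and on
the revenue per unit of starting inventory; their main terms have ratio `1 / F`. -/
theorem exists_valuations {M : ℝ} (hM : 0 < M) :
    ∃ (N : ℕ) (q : ℕ → Fin P.m),
      M * (∑ j, (Real.exp (P.bookingLimits j) - 1)) / P.F - ∑ j, (P.r j - P.prev j) ≤
        ∑ z ∈ Finset.range N, P.r (q (z + 1)) ∧
      M + ∑ z ∈ Finset.range N, max (P.r (q (z + 1)) - M / ((z : ℝ) + 1)) 0 ≤
        M * (∑ j, (Real.exp (P.bookingLimits j) - 1)) + ∑ j, P.r j := by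
  classical
  set α := P.bookingLimits with hα
  set d : Fin P.m → ℝ := fun j => P.r j * Real.exp (-α j) with hd
  have hF := P.F_pos
  have hd' : ∀ j, d j = P.r j - P.F * (P.r j - P.prev j) := P.r_mul_exp_neg_bookingLimits
  have d_pos : ∀ j, 0 < d j := fun j => mul_pos (P.r_pos j) (Real.exp_pos _)
  have d_mul : ∀ j, d j * Real.exp (α j) = P.r j := fun j => by
    simp only [hd]
    rw [mul_assoc, ← Real.exp_add, neg_add_cancel, Real.exp_zero, mul_one]
  have d_first : ∀ j, d P.first ≤ d j := by
    intro j
    have h0 : P.prev P.first = 0 := by simp [prev, first]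
    have h1 : P.r P.first ≤ P.r j := P.r_strictMono.monotone (Fin.le_def.2 (Nat.zero_le _))
    rw [hd', hd', h0]
    nlinarith [P.prev_nonneg j, P.F_lt_one]
  have hq : ∀ y : ℕ, ∃ q : Fin P.m, d P.first * y ≤ M →
      d q * y ≤ M ∧ ∀ j, d j * y ≤ M → j ≤ q := by
    intro y
    by_cases h : d P.first * y ≤ M
    · have hne : (Finset.univ.filter fun j => d j * y ≤ M).Nonempty := ⟨P.first, by simpa using h⟩
      refine ⟨_, fun _ => ⟨(Finset.mem_filter.1 (Finset.max'_mem _ hne)).2, fun j hj => ?_⟩⟩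
      exact Finset.le_max' _ _ (by simpa using hj)
    · exact ⟨P.first, fun h' => absurd h' h⟩
  choose q hq using hq
  set N : ℕ := ⌊M / d P.first⌋₊ with hN
  have hzN : ∀ z ∈ Finset.range N, d P.first * ((z + 1 : ℕ) : ℝ) ≤ M := by
    intro z hz
    have h1 : ((z + 1 : ℕ) : ℝ) ≤ M / d P.first :=
      (Nat.le_floor_iff (by have := d_pos P.first; positivity)).1 (Finset.mem_range.1 hz)
    rwa [le_div_iff₀' (d_pos _)] at h1
  -- The customers who can be charged `r j`, or more, come while at most `M / d j` items are left.
  have hfilter : ∀ j, (Finset.range N).filter (fun z => d j * ((z + 1 : ℕ) : ℝ) ≤ M) =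
      Finset.range ⌊M / d j⌋₊ := by
    intro j
    have h0 : (0 : ℝ) ≤ M / d j := by have := d_pos j; positivity
    have h1 : ⌊M / d j⌋₊ ≤ N :=
      Nat.floor_le_floor (div_le_div_of_nonneg_left hM.le (d_pos _) (d_first j))
    ext z
    rw [Finset.mem_filter, Finset.mem_range, Finset.mem_range, ← le_div_iff₀' (d_pos j),
      ← Nat.le_floor_iff h0]
    omega
  refine ⟨N, q, ?_, ?_⟩
  · have h1 : ∀ z ∈ Finset.range N, ∑ j, (if d j * ((z + 1 : ℕ) : ℝ) ≤ M then
        P.r j - P.prev j else 0) ≤ P.r (q (z + 1)) := by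
      intro z hz
      rw [← P.sum_Iic_r_sub_prev, ← Finset.sum_filter]
      refine Finset.sum_le_sum_of_subset_of_nonneg (fun j hj => ?_)
        fun j _ _ => (sub_pos.2 (P.prev_lt j)).le
      exact Finset.mem_Iic.2 ((hq (z + 1) (hzN z hz)).2 j (Finset.mem_filter.1 hj).2)
    refine le_trans ?_ (Finset.sum_le_sum h1)
    rw [Finset.sum_comm, Finset.mul_sum, Finset.sum_div, ← Finset.sum_sub_distrib]
    refine Finset.sum_le_sum fun j _ => ?_
    rw [← Finset.sum_filter, hfilter, Finset.sum_const, Finset.card_range, nsmul_eq_mul]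
    have h2 : M * (Real.exp (α j) - 1) / P.F = M / d j * (P.r j - P.prev j) := by
      have h3 := hd' j
      have h4 := d_mul j
      have h5 : P.F * (P.r j - P.prev j) = d j * (Real.exp (α j) - 1) := by linarith
      have := (d_pos j).ne'
      have := hF.ne'
      field_simp
      linarith
    have h6 := (Nat.lt_floor_add_one (M / d j)).le
    have h7 := mul_le_mul_of_nonneg_right h6 (sub_pos.2 (P.prev_lt j)).le
    rw [h2]
    linarith
  · have h1 : ∀ z ∈ Finset.range N, max (P.r (q (z + 1)) - M / ((z : ℝ) + 1)) 0 ≤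
        ∑ j, (if d j * ((z + 1 : ℕ) : ℝ) ≤ M then max (P.r j - M / ((z : ℝ) + 1)) 0 else 0) := by
      intro z hz
      refine le_trans ?_ (Finset.single_le_sum (fun j _ => ?_) (Finset.mem_univ (q (z + 1))))
      · rw [if_pos (hq (z + 1) (hzN z hz)).1]
      · split_ifs
        exacts [le_max_right _ _, le_rfl]
    have h2 : ∀ j, ∑ z ∈ Finset.range N, (if d j * ((z + 1 : ℕ) : ℝ) ≤ M then
        max (P.r j - M / ((z : ℝ) + 1)) 0 else 0) ≤
        M * (Real.exp (α j) - 1 - α j) + P.r j := by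
      intro j
      rw [← Finset.sum_filter, hfilter]
      refine sum_max_sub_div_le hM (P.r_pos j) (P.isBookingLimits_bookingLimits.1 j).le ?_
      have h3 : d j * ⌊M / d j⌋₊ ≤ M := by
        rw [← le_div_iff₀' (d_pos j)]
        exact Nat.floor_le (by have := d_pos j; positivity)
      have h4 := mul_le_mul_of_nonneg_right h3 (Real.exp_pos (α j)).le
      rw [← d_mul j]
      linarith
    have h3 := (Finset.sum_le_sum h1).trans (Finset.sum_comm.trans_le
      (Finset.sum_le_sum fun j _ => h2 j))
    have h4 : ∑ j, (M * (Real.exp (α j) - 1 - α j) + P.r j) =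
        M * (∑ j, (Real.exp (α j) - 1)) - M + ∑ j, P.r j := by
      rw [Finset.sum_add_distrib, ← Finset.mul_sum, Finset.sum_sub_distrib (g := α),
        P.isBookingLimits_bookingLimits.2.1]
      ring
    linarith

end PriceSet

/-! ### The hard instance -/

theorem exists_hard_distribution (k : ℕ) (hk : 0 < k) (P : PriceSet) {ε : ℝ} (hε : 0 < ε) :
    ∃ S : Setup, (∀ i, S.k i = k) ∧ (∀ i, S.P i = P) ∧
      ∃ D : PMF (ArrivalSeq S), D.support.Finite ∧
        (∀ A ∈ D.support, A.IsDeterministic) ∧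
        0 < expect D OPT ∧
        ∀ alg : OnlineAlgorithm S,
          expect D alg.expectedRevenue ≤ (P.F + ε) * expect D OPT := by
  have hF := P.F_pos
  set T : ℝ := ∑ j, (Real.exp (P.bookingLimits j) - 1) with hT
  set C₁ : ℝ := ∑ j, P.r j with hC₁
  set C₂ : ℝ := ∑ j, (P.r j - P.prev j) with hC₂
  have hne : (Finset.univ : Finset (Fin P.m)).Nonempty := ⟨P.first, Finset.mem_univ _⟩
  have T_pos : 0 < T := Finset.sum_pos (fun j _ => sub_pos.2
    (Real.one_lt_exp_iff.2 (P.isBookingLimits_bookingLimits.1 j))) hne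
  have C₁_pos : 0 < C₁ := Finset.sum_pos (fun j _ => P.r_pos j) hne
  have C₂_pos : 0 < C₂ := Finset.sum_pos (fun j _ => sub_pos.2 (P.prev_lt j)) hne
  -- `M` is so large that the slack `ε` in the ratio pays for the additive constants.
  set M : ℝ := (C₁ + (P.F + ε) * C₂) * P.F / (ε * T) with hM
  have M_pos : 0 < M := by positivity
  have hslack : M * T + C₁ = (P.F + ε) * (M * T / P.F - C₂) := by
    have : M * T * ε / P.F = C₁ + (P.F + ε) * C₂ := by
      rw [hM]
      field_simp
    have h2 : (P.F + ε) * (M * T / P.F - C₂) = M * T + M * T * ε / P.F - (P.F + ε) * C₂ := by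
      field_simp
    linarith
  have hlow : 0 < M * T / P.F - C₂ := by
    refine pos_of_mul_pos_right (a := P.F + ε) ?_ (by positivity)
    rw [← hslack]
    positivity
  obtain ⟨N, q, h1, h2⟩ := P.exists_valuations M_pos
  have hN : 0 < N := by
    rcases Nat.eq_zero_or_pos N with rfl | h
    · rw [Finset.range_zero, Finset.sum_empty] at h1
      linarith
    · exact h
  let S : Setup := ⟨N, hN, fun _ => k, fun _ => hk, fun _ => P⟩
  have hk' : (0 : ℝ) < k := by exact_mod_cast hk
  have hopt := le_expect_OPT_arrivals (S := S) (k := k) (fun _ => rfl)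
    (v := fun y => P.r (q y)) fun z _ _ _ => ⟨q z, rfl⟩
  have hopt' := (mul_le_mul_of_nonneg_left h1 hk'.le).trans hopt
  refine ⟨S, fun _ => rfl, fun _ => rfl, arrivals S k (fun y => P.r (q y)) S.n Finset.univ,
    finite_support_arrivals _ _ _ _ _, fun A => isDeterministic_of_mem_support_arrivals,
    (mul_pos hk' hlow).trans_le hopt', fun alg => ?_⟩
  calc _ ≤ k * (M + ∑ z ∈ Finset.range S.n, max (P.r (q (z + 1)) - M / ((z : ℝ) + 1)) 0) :=
        alg.expect_expectedRevenue_arrivals_le M_pos.le (fun _ => rfl) _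
    _ ≤ k * (M * T + C₁) := mul_le_mul_of_nonneg_left h2 hk'.le
    _ = (P.F + ε) * (k * (M * T / P.F - C₂)) := by rw [hslack]; ring
    _ ≤ _ := mul_le_mul_of_nonneg_left hopt' (by positivity)

theorem theorem3 (k : ℕ) (hk : 0 < k) (P : PriceSet) :
    (∀ ε : ℝ, 0 < ε →
      ∃ S : Setup, (∀ i, S.k i = k) ∧ (∀ i, S.P i = P) ∧
        ∃ D : PMF (ArrivalSeq S), D.support.Finite ∧
          (∀ A ∈ D.support, A.IsDeterministic) ∧
          0 < expect D OPT ∧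
          ∀ alg : OnlineAlgorithm S,
            expect D alg.expectedRevenue ≤ (P.F + ε) * expect D OPT) ∧
    (∀ c : ℝ, P.F < c →
      ∃ S : Setup, (∀ i, S.k i = k) ∧ (∀ i, S.P i = P) ∧
        ∀ alg : OnlineAlgorithm S, ¬ alg.IsDetCompetitive c) := by
  refine ⟨fun ε hε => exists_hard_distribution k hk P hε, fun c hc => ?_⟩
  obtain ⟨S, hS₁, hS₂, D, hD, hdet, hpos, hD'⟩ :=
    exists_hard_distribution k hk P (half_pos (sub_pos.2 hc))
  refine ⟨S, hS₁, hS₂, fun alg hcomp => ?_⟩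
  have h1 : c * expect D OPT ≤ expect D alg.expectedRevenue := by
    rw [← expect_const_mul]
    exact expect_mono hD fun A hA => hcomp A (hdet A hA)
  have h2 := le_of_mul_le_mul_right (h1.trans (hD' alg)) hpos
  linarith
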